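/- Let $V$ be a finite set, let $G=(V,E)$ be the complete graph on $V$, and let $c$ be symmetric metric costs on $V$, i.e. $c_{ij}=c_{ji}\ge 0$ and $c_{ij}\le c_{ik}+c_{kj}$ for all $i,j,k\in V$. For $S\subseteq V$ let $\delta(S)$ be the set of edges with exactly one endpoint in $S$, write $\delta(v)=\delta(\{v\})$, and put $x(F)=\sum_{e\in F}x_e$. Consider the following problems of minimizing $\sum_{e\in E}c_e x_e$ over vectors $x\in\mathbb{R}^E$. - 2ECM-IP: $x(\delta(S))\ge 2$ for all $\emptyset\ne S\subsetneq V$, and $x_e\in\mathbb{Z}$, $x_e\ge 0$ for all $e\in E$. - 2ECM-LP: $x(\delta(v))=2$ for all $v\in V$, $x(\delta(S))\ge 2$ for all $\emptyset\ne S\subsetneq V$, and $x_e\ge 0$ for all $e\in E$. - TSP-IP: $x$ is the incidence vector of the edge set of a Hamiltonian cycle of $G$. - TSP-LP: $x(\delta(v))=2$ for all $v\in V$, $x(\delta(S))\ge 2$ for all $\emptyset\ne S\subsetneq V$, and $0\le x_e\le 1$ for all $e\in E$. Suppose that 1. the incidence vector of some Hamiltonian cycle $T$ of $G$ is the unique optimal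 solution of 2ECM-IP, and 2. 2ECM-LP has an optimal solution $x$ that is half-integral, i.e. $x_e\in\{0,\tfrac12,1\}$ for all $e\in E$. Then the integrality gap of the TSP on this instance is at most $\tfrac43$: TSP-IP and TSP-LP attain their optimal values $\mathrm{OPT}_{\mathrm{TSP-IP}}$ and $\mathrm{OPT}_{\mathrm{TSP-LP}}$, one has $\mathrm{OPT}_{\mathrm{TSP-LP}}>0$, and $$\frac{\mathrm{OPT}_{\mathrm{TSP-IP}}}{\mathrm{OPT}_{\mathrm{TSP-LP}}}\le\frac43 .$$ -/

import Mathlib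

namespace TourGap

/-- The edges of the complete graph on `V`. -/
abbrev Edge (V : Type*) : Type _ := ↥((⊤ : SimpleGraph V).edgeSet)

/-- Symmetric metric costs: nonnegative and satisfying the triangle inequality.
Symmetry is built in, since costs are functions of unordered pairs. -/
structure IsMetricCost {V : Type*} (c : Sym2 V → ℝ) : Prop where
  nonneg : ∀ e, 0 ≤ c e
  triangle : ∀ i j k, c s(i, j) ≤ c s(i, k) + c s(k, j)

section Problems

variable {V : Type*} [Fintype V] [DecidableEq V]

/-- `cut S` is `δ(S)`: the edges with exactly one endpoint in `S`. -/
def cut (S : Finset V) : Finset (Edge V) :=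
  Finset.univ.filter fun e => ∃ u ∈ S, ∃ v ∉ S, e.1 = s(u, v)

/-- The objective value `∑ e, c e * x e`. -/
def cost (c : Sym2 V → ℝ) (x : Edge V → ℝ) : ℝ :=
  ∑ e : Edge V, c e.1 * x e

/-- `x(δ(S)) ≥ 2` for every nonempty proper vertex set `S`. -/
def CutConstraints (x : Edge V → ℝ) : Prop :=
  ∀ S : Finset V, S ≠ ∅ → S ≠ Finset.univ → 2 ≤ ∑ e ∈ cut S, x e

/-- `x(δ(v)) = 2` for every vertex `v`. -/
def DegreeConstraints (x : Edge V → ℝ) : Prop :=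
  ∀ v : V, ∑ e ∈ cut {v}, x e = 2

variable (V) in
/-- Feasible set of 2ECM-IP (edge multiplicities of 2-edge-connected spanning multisubgraphs). -/
def twoECMIP : Set (Edge V → ℝ) :=
  {x | CutConstraints x ∧ (∀ e, 0 ≤ x e) ∧ ∀ e, ∃ k : ℤ, x e = k}

variable (V) in
/-- Feasible set of 2ECM-LP. -/
def twoECMLP : Set (Edge V → ℝ) :=
  {x | DegreeConstraints x ∧ CutConstraints x ∧ ∀ e, 0 ≤ x e}

variable (V) in
/-- Feasible set of TSP-LP. -/
def tspLP : Set (Edge V → ℝ) :=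
  {x | DegreeConstraints x ∧ CutConstraints x ∧ ∀ e, 0 ≤ x e ∧ x e ≤ 1}

/-- The incidence vector of the edge set of a walk in the complete graph. -/
def incidence {a b : V} (T : (⊤ : SimpleGraph V).Walk a b) : Edge V → ℝ :=
  fun e => if e.1 ∈ T.edges then 1 else 0

variable (V) in
/-- Feasible set of TSP-IP: the incidence vectors of Hamiltonian cycles. -/
def tspIP : Set (Edge V → ℝ) :=
  {x | ∃ (a : V) (T : (⊤ : SimpleGraph V).Walk a a), T.IsHamiltonianCycle ∧ x = incidence T}

/-- `x` is an optimal solution of minimizing `cost c` over `P`. -/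
def IsOptimalSolution (P : Set (Edge V → ℝ)) (c : Sym2 V → ℝ) (x : Edge V → ℝ) : Prop :=
  x ∈ P ∧ ∀ y ∈ P, cost c x ≤ cost c y

/-- `r` is the (attained) optimal value of minimizing `cost c` over `P`. -/
def IsOptimalValue (P : Set (Edge V → ℝ)) (c : Sym2 V → ℝ) (r : ℝ) : Prop :=
  IsLeast (cost c '' P) r

/-- Every entry of `x` is `0`, `1/2` or `1`. -/
def IsHalfIntegral (x : Edge V → ℝ) : Prop :=
  ∀ e, x e = 0 ∨ x e = 1 / 2 ∨ x e = 1

end Problems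

end TourGap

namespace TourGap

/-! ### Cut functions of indexed multigraphs: submodularity and parity. -/

section Crossing

variable {V ι : Type*} [DecidableEq V]

/-! Doubling the half-integral optimum `x` gives a 4-regular, 4-edge-connected multigraph of cost `2
c(x)`. By `exists_twoConnected_subgraph`, after deleting any edge `e` it has a spanning
2-edge-connected subgraph costing at most 2/3 of what remains, hence at most `4/3 c(x)`. This
subgraph is feasible for 2ECM-IP, so the optimal tour `T` costs no more. Since `x ≤ 1`, `x` is also
optimal for TSP-LP, and the gap follows.

The subgraph lemma is an induction on the number of vertices. At an end `v` of `e`, with other edges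
`f, g, h`, split off completely: `e` pairs with one of the three, and the other two merge. By
submodularity and parity (`splittable_or_splittable`) at least two of the three pairings preserve
4-edge-connectivity. The merged edge receives a modified cost such that lifting the inductive
solution (`exists_lift`) has the same surcharge whether or not that edge is used. Averaging the
bounds of two admissible pairings gives exactly the factor 2/3. Modified costs may be negative, so
the induction allows arbitrary real costs. -/

open Classical in
/-- `1` if the edge `e` has exactly one endpoint in `S`, and `0` otherwise. -/
noncomputable def crossing (S : Finset V) (e : Sym2 V) : ℕ :=
  if ∃ u ∈ S, ∃ v ∉ S, e = s(u, v) then 1 else 0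

theorem crossing_mk (S : Finset V) (a b : V) :
    crossing S s(a, b) = if (a ∈ S ↔ b ∈ S) then 0 else 1 := by
  unfold crossing
  by_cases ha : a ∈ S <;> by_cases hb : b ∈ S <;> simp [ha, hb] <;> grind

/-- The number of edges with index in `E` that cross `S`, in the multigraph whose edge with
index `i` is `ends i`. -/
noncomputable def cutSize (E : Finset ι) (ends : ι → Sym2 V) (S : Finset V) : ℕ :=
  ∑ i ∈ E, crossing S (ends i)

/-- Submodularity holds edge by edge; only edges between `A \ B` and `B \ A` make it strict. -/
theorem cutSize_inter_add_union_le (E : Finset ι) (ends : ι → Sym2 V) (A B : Finset V) :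
    cutSize E ends (A ∩ B) + cutSize E ends (A ∪ B) ≤ cutSize E ends A + cutSize E ends B := by
  simp only [cutSize, ← Finset.sum_add_distrib]
  refine Finset.sum_le_sum fun i _ => ?_
  induction ends i with | _ a b
  simp only [crossing_mk, Finset.mem_inter, Finset.mem_union]
  by_cases a ∈ A <;> by_cases b ∈ A <;> by_cases a ∈ B <;> by_cases b ∈ B <;> simp [*]

omit [DecidableEq V] in
theorem cutSize_congr {E : Finset ι} {ends ends' : ι → Sym2 V} {S S' : Finset V}
    (h : ∀ i ∈ E, crossing S (ends i) = crossing S' (ends' i)) :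
    cutSize E ends S = cutSize E ends' S' :=
  Finset.sum_congr rfl h

theorem crossing_congr {S S' : Finset V} {e : Sym2 V} (h : ∀ w ∈ e, (w ∈ S ↔ w ∈ S')) :
    crossing S e = crossing S' e := by
  induction e with | _ a b
  simp [crossing_mk, h a, h b]

theorem crossing_sdiff {W S : Finset V} {e : Sym2 V} (h : ∀ w ∈ e, w ∈ W) :
    crossing (W \ S) e = crossing S e := by
  induction e with | _ a b
  simp [crossing_mk, h a, h b, not_iff_not]

/-- Modulo 2 a cut is the sum of the degrees inside it, since an edge within `S` is counted twice.
-/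
theorem even_cutSize {E : Finset ι} {ends : ι → Sym2 V} {S : Finset V}
    (h : ∀ w ∈ S, Even (cutSize E ends {w})) : Even (cutSize E ends S) := by
  classical
  induction S using Finset.induction_on with
  | empty =>
    have : cutSize E ends ∅ = 0 := by simp [cutSize, crossing]
    simp [this]
  | insert w S hw ih =>
    have key : Even (cutSize E ends (insert w S) + (cutSize E ends S + cutSize E ends {w})) := by
      simp only [cutSize, ← Finset.sum_add_distrib]
      refine Finset.even_sum _ fun i _ => ?_
      induction ends i with | _ a b
      simp only [crossing_mk, Finset.mem_insert, Finset.mem_singleton]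
      by_cases haw : a = w <;> by_cases hbw : b = w <;> by_cases a ∈ S <;> by_cases b ∈ S <;>
        simp_all
    have h1 := ih fun x hx => h x (Finset.mem_insert_of_mem hx)
    have h2 := h w (Finset.mem_insert_self w S)
    grind

end Crossing

/-! ### Which complete splittings at a degree-four vertex are admissible. -/

section Splitting

variable {V : Type*} [DecidableEq V]

/-- If splitting off the pairs `u, x` and `y, z` at a vertex with neighbours `u, x, y, z`
destroys `4`-edge-connectivity, then some tight set separates `u, x` from `y, z`.
Here `D` is the cut function of the graph without that vertex. -/
theorem exists_tight_of_not_splittable {W : Finset V} {D : Finset V → ℕ} {u x y z : V}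
    (hu : u ∈ W) (hx : x ∈ W) (hy : y ∈ W) (hz : z ∈ W)
    (hcompl : ∀ S ⊆ W, D (W \ S) = D S)
    (hconn : ∀ S ⊆ W, S.Nonempty → 4 ≤ D S + ((if u ∈ S then 1 else 0) +
      (if x ∈ S then 1 else 0) + (if y ∈ S then 1 else 0) + (if z ∈ S then 1 else 0)))
    (heven : ∀ S ⊆ W, Even (D S + ((if u ∈ S then 1 else 0) +
      (if x ∈ S then 1 else 0) + (if y ∈ S then 1 else 0) + (if z ∈ S then 1 else 0))))
    (hbad : ¬ ∀ S ⊆ W, S.Nonempty → S ≠ W →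
      4 ≤ D S + crossing S s(u, x) + crossing S s(y, z)) :
    ∃ A ⊆ W, u ∈ A ∧ x ∈ A ∧ y ∉ A ∧ z ∉ A ∧ D A ≤ 2 := by
  push Not at hbad
  obtain ⟨S, hSW, hSne, hS, hlt⟩ := hbad
  have h1 := hconn S hSW hSne
  have h2 := hconn (W \ S) Finset.sdiff_subset (by
    rw [Finset.sdiff_nonempty]
    exact fun h => hS (hSW.antisymm h))
  have h3 := heven S hSW
  rw [hcompl S hSW] at h2
  simp only [crossing_mk] at hlt
  -- If `S` contains `k` of the four ends, `h1` and `h2` give `D S ≥ max (4 - k) k`. With the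
  -- crossing new edges this already reaches 4, unless `S` separates `u, x` from `y, z`; there
  -- parity lowers `D S < 4` to `D S ≤ 2`.
  by_cases huS : u ∈ S <;> by_cases hxS : x ∈ S <;> by_cases hyS : y ∈ S <;>
    by_cases hzS : z ∈ S <;> simp [*] at h1 h2 h3 hlt <;> try omega
  · exact ⟨S, hSW, huS, hxS, hyS, hzS, by grind⟩
  · exact ⟨W \ S, Finset.sdiff_subset, by simp [*], by simp [*], by simp [*], by simp [*], by
      rw [hcompl S hSW]; grind⟩

/-- At a vertex of degree four in a `4`-regular, `4`-edge-connected graph, at most one of the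
three ways to split off completely destroys `4`-edge-connectivity. -/
theorem splittable_or_splittable {W : Finset V} {D : Finset V → ℕ} {u x y z : V}
    (hu : u ∈ W) (hx : x ∈ W) (hy : y ∈ W) (hz : z ∈ W)
    (hcompl : ∀ S ⊆ W, D (W \ S) = D S)
    (hsub : ∀ A B, D (A ∩ B) + D (A ∪ B) ≤ D A + D B)
    (hconn : ∀ S ⊆ W, S.Nonempty → 4 ≤ D S + ((if u ∈ S then 1 else 0) +
      (if x ∈ S then 1 else 0) + (if y ∈ S then 1 else 0) + (if z ∈ S then 1 else 0)))
    (heven : ∀ S ⊆ W, Even (D S + ((if u ∈ S then 1 else 0) +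
      (if x ∈ S then 1 else 0) + (if y ∈ S then 1 else 0) + (if z ∈ S then 1 else 0)))) :
    (∀ S ⊆ W, S.Nonempty → S ≠ W → 4 ≤ D S + crossing S s(u, x) + crossing S s(y, z)) ∨
    (∀ S ⊆ W, S.Nonempty → S ≠ W → 4 ≤ D S + crossing S s(u, y) + crossing S s(x, z)) := by
  by_contra hcon
  rw [not_or] at hcon
  obtain ⟨A, hAW, huA, hxA, hyA, hzA, hA⟩ :=
    exists_tight_of_not_splittable hu hx hy hz hcompl hconn heven hcon.1
  obtain ⟨B, hBW, huB, hyB, hxB, hzB, hB⟩ :=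
    exists_tight_of_not_splittable hu hy hx hz hcompl
      (fun S hS hne => by have := hconn S hS hne; omega)
      (fun S hS => by have := heven S hS; grind) hcon.2
  -- Of the four ends, `A ∩ B` contains only `u` and the complement of `A ∪ B` only `z`, so both
  -- have `D ≥ 3`; submodularity would give `6 ≤ 2 + 2`.
  have h1 := hconn (A ∩ B) (Finset.inter_subset_left.trans hAW)
    ⟨u, Finset.mem_inter.2 ⟨huA, huB⟩⟩
  have h2 := hconn (W \ (A ∪ B)) Finset.sdiff_subset ⟨z, by simp [*]⟩
  rw [hcompl _ (Finset.union_subset hAW hBW)] at h2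
  have h3 := hsub A B
  simp [*] at h1 h2
  omega

end Splitting

end TourGap
namespace TourGap

/-! ### Cheap 2-edge-connected subgraphs of 4-regular, 4-edge-connected multigraphs. -/

section HalfIntegral

variable {V ι : Type*} [DecidableEq V]

/-- A loopless multigraph on the vertex set `W` that is `4`-regular and `4`-edge-connected. -/
structure IsFourRegularFourConnected (W : Finset V) (E : Finset ι) (ends : ι → Sym2 V) :
    Prop where
  mem : ∀ i ∈ E, ∀ w ∈ ends i, w ∈ W
  loopless : ∀ i ∈ E, ¬ (ends i).IsDiag
  degree : ∀ w ∈ W, cutSize E ends {w} = 4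
  conn : ∀ S ⊆ W, S.Nonempty → S ≠ W → 4 ≤ cutSize E ends S

/-- Every cut of the multigraph with vertex set `W` has at least two edges. -/
def IsTwoConnected (W : Finset V) (E : Finset ι) (ends : ι → Sym2 V) : Prop :=
  ∀ S ⊆ W, S.Nonempty → S ≠ W → 2 ≤ cutSize E ends S

/-- Attaching a vertex by two edges, possibly subdividing an edge `s(p, q)`, keeps a graph
`2`-edge-connected. -/
theorem isTwoConnected_attach [DecidableEq ι] {W : Finset V} {H : Finset ι} {ends : ι → Sym2 V}
    {v p q : V} {j k : ι} (hp : p ∈ W.erase v) (hq : q ∈ W.erase v)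
    (hv : ∀ i ∈ H, v ∉ ends i) (hj : ends j = s(v, p)) (hk : ends k = s(v, q))
    (hjk : j ≠ k)
    (hcut : ∀ S ⊆ W.erase v, S.Nonempty → S ≠ W.erase v →
      2 ≤ cutSize H ends S + crossing S s(p, q)) :
    IsTwoConnected W (insert j (insert k H)) ends := by
  intro S hSW hSne hS
  have hjH : j ∉ H := fun h => hv j h (by simp [hj])
  have hkH : k ∉ H := fun h => hv k h (by simp [hk])
  have hH : cutSize H ends (S.erase v) = cutSize H ends S :=
    cutSize_congr fun i hi => crossing_congr fun w hw => by
      have : w ≠ v := by rintro rfl; exact hv i hi hw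
      simp [this]
  have hsum : cutSize (insert j (insert k H)) ends S =
      crossing S s(v, p) + (crossing S s(v, q) + cutSize H ends S) := by
    rw [cutSize, Finset.sum_insert (by simp [*]), Finset.sum_insert hkH, hj, hk, cutSize]
  rw [hsum]
  rw [Finset.mem_erase] at hp hq
  -- When `S` or its complement in `W` is `{v}`, both new edges cross. Otherwise `hcut` applies: if
  -- `s(p, q)` crosses, then so does at least one of the new edges.
  by_cases h0 : (S.erase v).Nonempty
  · by_cases h1 : S.erase v = W.erase v
    · have hvS : v ∉ S := fun hvS => hS <| by
        have hvW := hSW hvS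
        rw [← Finset.insert_erase hvS, h1, Finset.insert_erase hvW]
      have hpS : p ∈ S := Finset.mem_of_mem_erase (h1 ▸ Finset.mem_erase.2 hp)
      have hqS : q ∈ S := Finset.mem_of_mem_erase (h1 ▸ Finset.mem_erase.2 hq)
      simp only [crossing_mk, hvS, hpS, hqS]
      simp
      omega
    · have h2 := hcut _ (Finset.erase_subset_erase _ hSW) h0 h1
      rw [hH] at h2
      simp only [crossing_mk, Finset.mem_erase] at h2 ⊢
      by_cases v ∈ S <;> by_cases p ∈ S <;> by_cases q ∈ S <;> simp [*] at h2 ⊢ <;> omega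
  · rw [Finset.not_nonempty_iff_eq_empty, Finset.erase_eq_empty_iff] at h0
    rcases h0 with rfl | rfl
    · simp at hSne
    · simp [crossing_mk, hp.1, hq.1]
      omega

/-- Undoing a complete splitting at `v`: a `2`-edge-connected subgraph of the split graph, where
`h` is the edge obtained from the edges `g` and `h` at `v`, lifts to the original graph. -/
theorem exists_lift [DecidableEq ι] {W : Finset V} {E₀ H₁ : Finset ι} {ends ends₁ : ι → Sym2 V}
    {c c₁ : ι → ℝ} {v x y z : V} {f g h : ι}
    (hx : x ∈ W.erase v) (hy : y ∈ W.erase v) (hz : z ∈ W.erase v)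
    (hv : ∀ i ∈ E₀, v ∉ ends i)
    (hf : ends f = s(v, x)) (hg : ends g = s(v, y)) (hh : ends h = s(v, z))
    (hfg : f ≠ g) (hgh : g ≠ h)
    (hends : ∀ i ∈ E₀, ends₁ i = ends i) (hends_h : ends₁ h = s(y, z))
    (hc : ∀ i ∈ E₀, c₁ i = c i) (hc_h : c₁ h = c h - c f)
    (hH₁ : H₁ ⊆ insert h E₀) (hconn : IsTwoConnected (W.erase v) H₁ ends₁) :
    ∃ H ⊆ insert f (insert g (insert h E₀)), IsTwoConnected W H ends ∧
      ∑ i ∈ H, c i = ∑ i ∈ H₁, c₁ i + c f + c g := by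
  have hfE : f ∉ E₀ := fun h => hv f h (by simp [hf])
  have hgE : g ∉ E₀ := fun h => hv g h (by simp [hg])
  have hhE : h ∉ E₀ := fun h' => hv h h' (by simp [hh])
  have hH₀ : H₁.erase h ⊆ E₀ := by
    rw [← Finset.subset_insert_iff]; exact hH₁
  have hcut : ∀ S, cutSize (H₁.erase h) ends₁ S = cutSize (H₁.erase h) ends S := fun S =>
    cutSize_congr fun i hi => by rw [hends i (hH₀ hi)]
  have hsum : ∑ i ∈ H₁.erase h, c₁ i = ∑ i ∈ H₁.erase h, c i :=
    Finset.sum_congr rfl fun i hi => hc i (hH₀ hi)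
  -- If the merged edge is used, subdivide it into `g, h`; if not, attach `v` by `f, g`. The cost `c
  -- h - c f` makes the surcharge `c f + c g` in both cases.
  by_cases hmem : h ∈ H₁
  · refine ⟨insert g (insert h (H₁.erase h)), ?_, ?_, ?_⟩
    · grind
    · refine isTwoConnected_attach hy hz (fun i hi => hv i (hH₀ hi)) hg hh hgh ?_
      intro S hS hne hSW
      have := hconn S hS hne hSW
      rw [← Finset.insert_erase hmem, cutSize, Finset.sum_insert (by simp), hends_h] at this
      rw [← hcut, cutSize]
      omega
    · rw [Finset.sum_insert (by grind), Finset.sum_insert (by simp),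
        ← Finset.add_sum_erase _ _ hmem, hsum, hc_h]
      ring
  · rw [Finset.erase_eq_of_notMem hmem] at hH₀ hcut hsum
    refine ⟨insert f (insert g H₁), ?_, ?_, ?_⟩
    · grind
    · refine isTwoConnected_attach hx hy (fun i hi => hv i (hH₀ hi)) hf hg hfg ?_
      intro S hS hne hSW
      have := hconn S hS hne hSW
      rw [hcut] at this
      omega
    · rw [Finset.sum_insert (by grind), Finset.sum_insert (by grind), hsum]
      ring

/-- The complete splitting of a `4`-regular graph at `v` that creates the edges `s(u, x)` and
`s(y, z)` is again `4`-regular and `4`-edge-connected, provided that it has no small cut. -/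
theorem isFourRegularFourConnected_split [DecidableEq ι] {W : Finset V} {E₀ : Finset ι}
    {ends ends₁ : ι → Sym2 V} {v u x y z : V} {e h : ι}
    (hu : u ∈ W.erase v) (hx : x ∈ W.erase v) (hy : y ∈ W.erase v) (hz : z ∈ W.erase v)
    (hmem : ∀ i ∈ E₀, ∀ w ∈ ends i, w ∈ W.erase v)
    (hloop : ∀ i ∈ E₀, ¬ (ends i).IsDiag)
    (heE : e ∉ E₀) (hhE : h ∉ E₀) (heh : e ≠ h)
    (hends : ∀ i ∈ E₀, ends₁ i = ends i) (hends_e : ends₁ e = s(u, x))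
    (hends_h : ends₁ h = s(y, z)) (hcard : W.card ≠ 2)
    (hdeg : ∀ w ∈ W.erase v, cutSize E₀ ends {w} + ((if u ∈ ({w} : Finset V) then 1 else 0) +
      (if x ∈ ({w} : Finset V) then 1 else 0) + (if y ∈ ({w} : Finset V) then 1 else 0) +
      (if z ∈ ({w} : Finset V) then 1 else 0)) = 4)
    (hvW : v ∈ W)
    (hgood : ∀ S ⊆ W.erase v, S.Nonempty → S ≠ W.erase v →
      4 ≤ cutSize E₀ ends S + crossing S s(u, x) + crossing S s(y, z)) :
    IsFourRegularFourConnected (W.erase v) (insert e (insert h E₀)) ends₁ := by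
  have hcut : ∀ S, cutSize (insert e (insert h E₀)) ends₁ S =
      cutSize E₀ ends S + crossing S s(u, x) + crossing S s(y, z) := fun S => by
    rw [cutSize, Finset.sum_insert (by simp [*]), Finset.sum_insert hhE, hends_e, hends_h,
      Finset.sum_congr rfl fun i hi => by rw [hends i hi], cutSize]
    ring
  -- `W.card ≠ 2` makes `{w}` a proper subset of `W.erase v`. These bounds exclude new loops, as a
  -- loop at `w` would absorb two of the four edge ends there.
  have hsing : ∀ w ∈ W.erase v, 4 ≤ cutSize E₀ ends {w} + crossing {w} s(u, x) +
      crossing {w} s(y, z) := fun w hw => by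
    refine hgood _ (by simpa using hw) (by simp) fun hW => hcard ?_
    rw [← Finset.card_erase_add_one hvW, ← hW, Finset.card_singleton]
  refine ⟨?_, ?_, ?_, ?_⟩
  · simp only [Finset.forall_mem_insert, hends_e, hends_h, Sym2.mem_iff, forall_eq_or_imp,
      forall_eq]
    exact ⟨⟨hu, hx⟩, ⟨hy, hz⟩, fun i hi => by rw [hends i hi]; exact hmem i hi⟩
  · simp only [Finset.forall_mem_insert, hends_e, hends_h, Sym2.mk_isDiag_iff]
    refine ⟨?_, ?_, fun i hi => by rw [hends i hi]; exact hloop i hi⟩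
    · rintro rfl
      have h1 := hdeg u hu
      have h2 := hsing u hu
      simp only [crossing_mk, Finset.mem_singleton] at h1 h2
      by_cases y = u <;> by_cases z = u <;> simp [*] at h1 h2 <;> omega
    · rintro rfl
      have h1 := hdeg y hy
      have h2 := hsing y hy
      simp only [crossing_mk, Finset.mem_singleton] at h1 h2
      by_cases u = y <;> by_cases x = y <;> simp [*] at h1 h2 <;> omega
  · intro w hw
    have h1 := hdeg w hw
    have h2 := hsing w hw
    rw [hcut]
    simp only [crossing_mk, Finset.mem_singleton] at h1 h2 ⊢
    by_cases u = w <;> by_cases x = w <;> by_cases y = w <;> by_cases z = w <;>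
      simp [*] at h1 h2 ⊢ <;> omega
  · intro S hS hne hSW
    rw [hcut]
    exact hgood S hS hne hSW

/-- A `4`-regular, `4`-edge-connected multigraph has, for every edge `e` and all real edge costs,
a spanning `2`-edge-connected subgraph that avoids `e` and costs at most two thirds of the
remaining edges. -/
theorem exists_twoConnected_subgraph [DecidableEq ι] (n : ℕ) :
    ∀ (W : Finset V) (E : Finset ι) (ends : ι → Sym2 V) (c : ι → ℝ), W.card = n →
      IsFourRegularFourConnected W E ends → ∀ e ∈ E,
      ∃ H ⊆ E.erase e, IsTwoConnected W H ends ∧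
        ∑ i ∈ H, c i ≤ 2 / 3 * ∑ i ∈ E.erase e, c i := by
  induction n with
  | zero =>
    intro W E ends c hW hG e he
    have := hG.mem e he
    rw [Finset.card_eq_zero.1 hW] at this
    exact absurd (this _ (ends e).out_fst_mem) (Finset.notMem_empty _)
  | succ n ih =>
    intro W E ends c hW hG e he
    obtain ⟨v, hve⟩ : ∃ v, v ∈ ends e := by
      induction ends e with | _ a b; exact ⟨a, by simp⟩
    have hvW : v ∈ W := hG.mem e he v hve
    -- the other edges at `v`
    have hcr : ∀ i ∈ E, crossing {v} (ends i) = if v ∈ ends i then 1 else 0 := fun i hi => by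
      have := hG.loopless i hi
      revert this
      induction ends i with | _ a b
      simp only [crossing_mk, Finset.mem_singleton, Sym2.mem_iff, Sym2.mk_isDiag_iff]
      grind
    have hcard : (E.filter fun i => v ∈ ends i).card = 4 := by
      rw [Finset.card_filter, ← hG.degree v hvW, cutSize, Finset.sum_congr rfl hcr]
    have heF : e ∈ E.filter fun i => v ∈ ends i := by simp [he, hve]
    obtain ⟨f, g, h, hfg, hfh, hgh, hF⟩ := Finset.card_eq_three.1
      (show ((E.filter fun i => v ∈ ends i).erase e).card = 3 by
        rw [Finset.card_erase_of_mem heF, hcard])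
    have hF' : E.filter (fun i => v ∈ ends i) = {e, f, g, h} := by
      rw [← Finset.insert_erase heF, hF]
    have hother : ∀ i ∈ E, v ∈ ends i → ∃ w ∈ W.erase v, ends i = s(v, w) := by
      intro i hi hvi
      obtain ⟨w, hw⟩ := Sym2.mem_iff_exists.1 hvi
      refine ⟨w, Finset.mem_erase.2 ⟨?_, hG.mem i hi w (by simp [hw])⟩, hw⟩
      rintro rfl
      exact hG.loopless i hi (by simp [hw])
    have hmemF : ∀ i ∈ ({e, f, g, h} : Finset ι), i ∈ E ∧ v ∈ ends i := fun i hi => by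
      rw [← hF'] at hi; simpa using hi
    have hef : e ≠ f := by rintro rfl; simpa using hF.symm.le (by simp : e ∈ ({e, g, h} : Finset ι))
    have heg : e ≠ g := by rintro rfl; simpa using hF.symm.le (by simp : e ∈ ({f, e, h} : Finset ι))
    have heh : e ≠ h := by rintro rfl; simpa using hF.symm.le (by simp : e ∈ ({f, g, e} : Finset ι))
    obtain ⟨u, hu, hends_e⟩ := hother e he hve
    obtain ⟨x, hx, hends_f⟩ := hother f (hmemF f (by simp)).1 (hmemF f (by simp)).2
    obtain ⟨y, hy, hends_g⟩ := hother g (hmemF g (by simp)).1 (hmemF g (by simp)).2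
    obtain ⟨z, hz, hends_h⟩ := hother h (hmemF h (by simp)).1 (hmemF h (by simp)).2
    obtain ⟨E₀, hE₀⟩ : ∃ E₀, E₀ = E.filter fun i => v ∉ ends i := ⟨_, rfl⟩
    have hE : E = insert e (insert f (insert g (insert h E₀))) := by
      have := Finset.filter_union_filter_not_eq (fun i => v ∈ ends i) E
      rw [hF', ← hE₀] at this
      rw [← this]
      simp [Finset.insert_union]
    have hvE₀ : ∀ i ∈ E₀, v ∉ ends i := fun i hi => by
      rw [hE₀] at hi; exact (Finset.mem_filter.1 hi).2
    have hE₀E : E₀ ⊆ E := hE₀ ▸ Finset.filter_subset _ _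
    have heE : e ∉ E₀ := fun h => hvE₀ e h hve
    have hfE : f ∉ E₀ := fun h => hvE₀ f h (by simp [hends_f])
    have hgE : g ∉ E₀ := fun h => hvE₀ g h (by simp [hends_g])
    have hhE : h ∉ E₀ := fun h' => hvE₀ h h' (by simp [hends_h])
    have hmem : ∀ i ∈ E₀, ∀ w ∈ ends i, w ∈ W.erase v := fun i hi w hw =>
      Finset.mem_erase.2 ⟨by rintro rfl; exact hvE₀ i hi hw, hG.mem i (hE₀E hi) w hw⟩
    have hloop : ∀ i ∈ E₀, ¬ (ends i).IsDiag := fun i hi => hG.loopless i (hE₀E hi)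
    have hcut : ∀ S ⊆ W.erase v, cutSize E ends S = cutSize E₀ ends S +
        ((if u ∈ S then 1 else 0) + (if x ∈ S then 1 else 0) + (if y ∈ S then 1 else 0) +
          (if z ∈ S then 1 else 0)) := by
      intro S hS
      have hvS : v ∉ S := fun h => Finset.notMem_erase v W (hS h)
      rw [hE, cutSize, Finset.sum_insert (by simp [hef, heg, heh, heE]),
        Finset.sum_insert (by simp [hfg, hfh, hfE]), Finset.sum_insert (by simp [hgh, hgE]),
        Finset.sum_insert hhE, hends_e, hends_f, hends_g,
        hends_h, cutSize]
      simp only [crossing_mk, hvS, false_iff, ite_not]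
      ring
    have hne : ∀ S ⊆ W.erase v, S ⊆ W ∧ S ≠ W := fun S hS =>
      ⟨hS.trans (Finset.erase_subset _ _), fun h => Finset.notMem_erase v W (hS (h ▸ hvW))⟩
    have hconn : ∀ S ⊆ W.erase v, S.Nonempty → 4 ≤ cutSize E ends S := fun S hS h =>
      hG.conn S (hne S hS).1 h (hne S hS).2
    have heven : ∀ S ⊆ W.erase v, Even (cutSize E ends S) := fun S hS =>
      even_cutSize fun w hw => by rw [hG.degree w ((hne S hS).1 hw)]; decide
    have hdeg : ∀ w ∈ W.erase v, cutSize E ends {w} = 4 := fun w hw =>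
      hG.degree w (Finset.mem_of_mem_erase hw)
    have hcompl : ∀ S ⊆ W.erase v, cutSize E₀ ends (W.erase v \ S) = cutSize E₀ ends S :=
      fun S _ => cutSize_congr fun i hi => crossing_sdiff (hmem i hi)
    have hsub := cutSize_inter_add_union_le E₀ ends
    have hErase : E.erase e = insert f (insert g (insert h E₀)) := by
      rw [hE, Finset.erase_insert (by simp [hef, heg, heh, heE])]
    rw [hErase, Finset.sum_insert (by simp [hfg, hfh, hfE]),
      Finset.sum_insert (by simp [hgh, hgE]), Finset.sum_insert hhE]
    clear hErase hF hF' hmemF heF hother hcard hcr hE₀ hE₀E hE he hends_e hve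
    -- With two vertices all edges are parallel: keep the two cheapest of `f, g, h`.
    by_cases hW2 : W.card = 2
    · obtain ⟨a, ha⟩ := Finset.card_eq_one.1
        (show (W.erase v).card = 1 by rw [Finset.card_erase_of_mem hvW, hW2])
      have hE₀ : E₀ = ∅ := Finset.eq_empty_of_forall_notMem fun i hi => by
        have h1 := hmem i hi
        have h2 := hloop i hi
        rw [ha] at h1
        revert h1 h2
        induction ends i with | _ p q
        simp only [Sym2.mem_iff, Sym2.mk_isDiag_iff, Finset.mem_singleton]
        exact fun h1 h2 => h2 ((h1 p (Or.inl rfl)).trans (h1 q (Or.inr rfl)).symm)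
      subst hE₀
      have two : ∀ (j k : ι) (p q : V), p ∈ W.erase v → q ∈ W.erase v → ends j = s(v, p) →
          ends k = s(v, q) → j ≠ k → IsTwoConnected W {j, k} ends := by
        intro j k p q hp hq hj hk hjk
        refine isTwoConnected_attach hp hq (H := ∅) (by simp) hj hk hjk ?_
        intro S hS hne hSW
        rw [ha, Finset.subset_singleton_iff] at hS
        rcases hS with rfl | rfl
        · simp at hne
        · exact absurd ha.symm hSW
      rcases le_total (c f) (c g) with h1 | h1 <;> rcases le_total (c g) (c h) with h2 | h2 <;>
        rcases le_total (c f) (c h) with h3 | h3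
      all_goals first
        | exact ⟨{f, g}, by simp [Finset.insert_subset_iff], two f g x y hx hy hends_f hends_g hfg, by
            rw [Finset.sum_pair hfg, Finset.sum_empty]; linarith⟩
        | exact ⟨{f, h}, by simp [Finset.insert_subset_iff], two f h x z hx hz hends_f hends_h hfh, by
            rw [Finset.sum_pair hfh, Finset.sum_empty]; linarith⟩
        | exact ⟨{g, h}, by simp, two g h y z hy hz hends_g hends_h hgh, by
            rw [Finset.sum_pair hgh, Finset.sum_empty]; linarith⟩
    have step : ∀ (f g h : ι) (x y z : V), x ∈ W.erase v → y ∈ W.erase v → z ∈ W.erase v →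
        ends f = s(v, x) → ends g = s(v, y) → ends h = s(v, z) → f ≠ g → g ≠ h → e ≠ h →
        (∀ S ⊆ W.erase v, cutSize E ends S = cutSize E₀ ends S +
          ((if u ∈ S then 1 else 0) + (if x ∈ S then 1 else 0) + (if y ∈ S then 1 else 0) +
            (if z ∈ S then 1 else 0))) →
        (∀ S ⊆ W.erase v, S.Nonempty → S ≠ W.erase v →
          4 ≤ cutSize E₀ ends S + crossing S s(u, x) + crossing S s(y, z)) →
        ∃ H ⊆ insert f (insert g (insert h E₀)), IsTwoConnected W H ends ∧
          ∑ i ∈ H, c i ≤ 2 / 3 * (∑ i ∈ E₀, c i + c h - c f) + c f + c g := by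
      clear! f g h x y z
      intro f g h x y z hx hy hz hends_f hends_g hends_h hfg hgh heh hcut hgood
      have hhE : h ∉ E₀ := fun h' => hvE₀ h h' (by simp [hends_h])
      have hne_e : ∀ i ∈ E₀, i ≠ e := fun i hi => by rintro rfl; exact heE hi
      have hne_h : ∀ i ∈ E₀, i ≠ h := fun i hi => by rintro rfl; exact hhE hi
      -- The labels `e` and `h` are reused for the new edges, so the inductive subgraph avoids the
      -- edge that comes from `e`.
      let ends₁ := Function.update (Function.update ends e s(u, x)) h s(y, z)
      let c₁ := Function.update c h (c h - c f)
      have hends₁ : ∀ i ∈ E₀, ends₁ i = ends i := fun i hi => by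
        simp [ends₁, hne_e i hi, hne_h i hi]
      have hends₁_e : ends₁ e = s(u, x) := by simp [ends₁, heh]
      have hends₁_h : ends₁ h = s(y, z) := by simp [ends₁]
      have hc₁ : ∀ i ∈ E₀, c₁ i = c i := fun i hi => by simp [c₁, hne_h i hi]
      have hc₁_h : c₁ h = c h - c f := by simp [c₁]
      have hG₁ := isFourRegularFourConnected_split hu hx hy hz hmem hloop heE hhE heh hends₁
        hends₁_e hends₁_h hW2 (fun w hw => by
          rw [← hcut _ (by simpa using hw)]; exact hdeg w hw) hvW hgood
      obtain ⟨H₁, hH₁, hconn₁, hcost₁⟩ := ih (W.erase v) _ ends₁ c₁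
        (by rw [Finset.card_erase_of_mem hvW, hW]; rfl) hG₁ e (Finset.mem_insert_self _ _)
      rw [Finset.erase_insert (by simp [heh, heE])] at hH₁ hcost₁
      obtain ⟨H, hH, hHconn, hHcost⟩ := exists_lift hx hy hz hvE₀ hends_f hends_g hends_h hfg
        hgh hends₁ hends₁_h hc₁ hc₁_h hH₁ hconn₁
      refine ⟨H, hH, hHconn, ?_⟩
      rw [Finset.sum_insert hhE, hc₁_h, Finset.sum_congr rfl hc₁] at hcost₁
      rw [hHcost]
      linarith
    -- two different splittings suffice, by averaging
    have finish : ∀ (f g h : ι) (x y z : V), x ∈ W.erase v → y ∈ W.erase v → z ∈ W.erase v →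
        ends f = s(v, x) → ends g = s(v, y) → ends h = s(v, z) → f ≠ g → g ≠ h → f ≠ h → e ≠ h →
        (∀ S ⊆ W.erase v, cutSize E ends S = cutSize E₀ ends S +
          ((if u ∈ S then 1 else 0) + (if x ∈ S then 1 else 0) + (if y ∈ S then 1 else 0) +
            (if z ∈ S then 1 else 0))) →
        (∀ S ⊆ W.erase v, S.Nonempty → S ≠ W.erase v →
          4 ≤ cutSize E₀ ends S + crossing S s(u, x) + crossing S s(y, z)) →
        (∀ S ⊆ W.erase v, S.Nonempty → S ≠ W.erase v →
          4 ≤ cutSize E₀ ends S + crossing S s(u, y) + crossing S s(x, z)) →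
        ∃ H ⊆ insert f (insert g (insert h E₀)), IsTwoConnected W H ends ∧
          ∑ i ∈ H, c i ≤ 2 / 3 * (c f + (c g + (c h + ∑ i ∈ E₀, c i))) := by
      clear! f g h x y z
      intro f g h x y z hx hy hz hends_f hends_g hends_h hfg hgh hfh heh hcut hgood hgood'
      obtain ⟨H, hH, hconn, hcost⟩ := step f g h x y z hx hy hz hends_f hends_g hends_h hfg hgh
        heh hcut hgood
      obtain ⟨H', hH', hconn', hcost'⟩ := step g f h y x z hy hx hz hends_g hends_f hends_h
        hfg.symm hfh heh (fun S hS => by rw [hcut S hS]; ring) hgood'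
      rw [Finset.insert_comm] at hH'
      -- The bounds carry `-2/3 * c f` and `-2/3 * c g` respectively; their average is the desired
      -- one, so the cheaper subgraph works.
      rcases le_total (∑ i ∈ H, c i) (∑ i ∈ H', c i) with hle | hle
      · exact ⟨H, hH, hconn, by linarith⟩
      · exact ⟨H', hH', hconn', by linarith⟩
    have pair : ∀ x y z : V, x ∈ W.erase v → y ∈ W.erase v → z ∈ W.erase v →
        (∀ S ⊆ W.erase v, cutSize E ends S = cutSize E₀ ends S +
          ((if u ∈ S then 1 else 0) + (if x ∈ S then 1 else 0) + (if y ∈ S then 1 else 0) +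
            (if z ∈ S then 1 else 0))) →
        (∀ S ⊆ W.erase v, S.Nonempty → S ≠ W.erase v →
          4 ≤ cutSize E₀ ends S + crossing S s(u, x) + crossing S s(y, z)) ∨
        (∀ S ⊆ W.erase v, S.Nonempty → S ≠ W.erase v →
          4 ≤ cutSize E₀ ends S + crossing S s(u, y) + crossing S s(x, z)) := by
      intro x y z hx hy hz hcut
      exact splittable_or_splittable hu hx hy hz hcompl hsub
        (fun S hS => by rw [← hcut S hS]; exact hconn S hS)
        (fun S hS => by rw [← hcut S hS]; exact heven S hS)
    have hcut_fhg : ∀ S ⊆ W.erase v, cutSize E ends S = cutSize E₀ ends S +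
        ((if u ∈ S then 1 else 0) + (if x ∈ S then 1 else 0) + (if z ∈ S then 1 else 0) +
          (if y ∈ S then 1 else 0)) := fun S hS => by rw [hcut S hS]; ring
    have hcut_ghf : ∀ S ⊆ W.erase v, cutSize E ends S = cutSize E₀ ends S +
        ((if u ∈ S then 1 else 0) + (if y ∈ S then 1 else 0) + (if z ∈ S then 1 else 0) +
          (if x ∈ S then 1 else 0)) := fun S hS => by rw [hcut S hS]; ring
    have hswap : ∀ a b : V, s(a, b) = s(b, a) := fun _ _ => Sym2.eq_swap
    have hxy := pair x y z hx hy hz hcut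
    have hxz := pair x z y hx hz hy hcut_fhg
    have hyz := pair y z x hy hz hx hcut_ghf
    rw [hswap z y] at hxz
    rw [hswap z x, hswap y x] at hyz
    have hfgh : insert f (insert h (insert g E₀)) = insert f (insert g (insert h E₀)) := by
      rw [Finset.insert_comm h g]
    have hghf : insert g (insert h (insert f E₀)) = insert f (insert g (insert h E₀)) := by
      rw [Finset.insert_comm h f, Finset.insert_comm g f]
    -- At most one pairing fails; `finish` is applied to two that succeed, with the edges relabelled
    -- accordingly.
    by_cases hX : ∀ S ⊆ W.erase v, S.Nonempty → S ≠ W.erase v →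
          4 ≤ cutSize E₀ ends S + crossing S s(u, x) + crossing S s(y, z)
    · by_cases hY : ∀ S ⊆ W.erase v, S.Nonempty → S ≠ W.erase v →
          4 ≤ cutSize E₀ ends S + crossing S s(u, y) + crossing S s(x, z)
      · exact finish f g h x y z hx hy hz hends_f hends_g hends_h hfg hgh hfh heh hcut hX hY
      · have hZ := hyz.resolve_left hY
        obtain ⟨H, hH, hHconn, hcost⟩ := finish f h g x z y hx hz hy hends_f hends_h hends_g hfh
          hgh.symm hfg heg hcut_fhg (by rwa [hswap z y]) hZ
        exact ⟨H, hfgh ▸ hH, hHconn, by linarith⟩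
    · have hY := hxy.resolve_left hX
      have hZ := hxz.resolve_left hX
      obtain ⟨H, hH, hHconn, hcost⟩ := finish g h f y z x hy hz hx hends_g hends_h hends_f hgh
        hfh.symm hfg.symm hef hcut_ghf (by rwa [hswap z x]) (by rwa [hswap y x])
      exact ⟨H, hghf ▸ hH, hHconn, by linarith⟩

end HalfIntegral

end TourGap
namespace TourGap

/-! ### From the multigraph back to the linear and integer programs. -/

section Gap

variable {V : Type*} [Fintype V] [DecidableEq V]

theorem sum_cut_eq (S : Finset V) (x : Edge V → ℝ) :
    ∑ e ∈ cut S, x e = ∑ e, x e * crossing S e.1 := by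
  rw [cut, Finset.sum_filter]
  refine Finset.sum_congr rfl fun e _ => ?_
  unfold crossing
  split_ifs <;> simp

/-- The number of times that the edge `e` occurs in a set of indexed copies of edges. -/
noncomputable def multiplicity (H : Finset (Edge V × ℕ)) (e : Edge V) : ℝ :=
  ((H.filter fun i => i.1 = e).card : ℝ)

theorem sum_mul_multiplicity (H : Finset (Edge V × ℕ)) (r : Edge V → ℝ) :
    ∑ e, r e * multiplicity H e = ∑ i ∈ H, r i.1 := by
  rw [← Finset.sum_fiberwise H (fun i => i.1)]
  refine Finset.sum_congr rfl fun e _ => ?_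
  rw [Finset.sum_congr rfl fun i hi => by rw [(Finset.mem_filter.1 hi).2], Finset.sum_const,
    nsmul_eq_mul, multiplicity, mul_comm]

theorem sum_cut_multiplicity (H : Finset (Edge V × ℕ)) (S : Finset V) :
    ∑ e ∈ cut S, multiplicity H e = cutSize H (fun i => i.1.1) S := by
  rw [sum_cut_eq, cutSize, Nat.cast_sum, ← sum_mul_multiplicity H fun e => (crossing S e.1 : ℝ)]
  exact Finset.sum_congr rfl fun e _ => mul_comm _ _

/-- A half-integral solution of 2ECM-LP gives a 2ECM-IP solution of at most `4/3` its cost. -/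
theorem exists_twoECMIP_cost_le {c : Sym2 V → ℝ} (hc : ∀ e, 0 ≤ c e) {x : Edge V → ℝ}
    (hx : x ∈ twoECMLP V) (hhalf : IsHalfIntegral x) [Nontrivial V] :
    ∃ y ∈ twoECMIP V, cost c y ≤ 4 / 3 * cost c x := by
  have hm : ∀ e, ∃ m : ℕ, (m : ℝ) = 2 * x e := fun e => by
    rcases hhalf e with h | h | h
    · exact ⟨0, by simp [h]⟩
    · exact ⟨1, by simp [h]⟩
    · exact ⟨2, by simp [h]⟩
  choose m hm using hm
  -- `2 * x e` labelled parallel copies of each edge `e`.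
  let E : Finset (Edge V × ℕ) :=
    Finset.univ.biUnion fun e => (Finset.range (m e)).map ⟨Prod.mk e, Prod.mk_right_injective e⟩
  have hE : ∀ e, multiplicity E e = 2 * x e := fun e => by
    have : E.filter (fun i => i.1 = e) =
        (Finset.range (m e)).map ⟨Prod.mk e, Prod.mk_right_injective e⟩ := by
      ext ⟨e', k⟩
      simp [E]
      grind
    rw [multiplicity, this, Finset.card_map, Finset.card_range, hm]
  have hcut : ∀ S, (cutSize E (fun i => i.1.1) S : ℝ) = 2 * ∑ e ∈ cut S, x e := fun S => by
    rw [← sum_cut_multiplicity, Finset.mul_sum]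
    exact Finset.sum_congr rfl fun e _ => hE e
  have hG : IsFourRegularFourConnected Finset.univ E (fun i => i.1.1) := by
    refine ⟨by simp, fun i _ => (⊤ : SimpleGraph V).not_isDiag_of_mem_edgeSet i.1.2, ?_, ?_⟩
    · intro w _
      have := hcut {w}
      rw [hx.1 w] at this
      exact_mod_cast this.trans (by norm_num : (2 * 2 : ℝ) = 4)
    · intro S _ hne hS
      have h1 := hcut S
      have h2 := hx.2.1 S hne.ne_empty hS
      have : (4 : ℝ) ≤ cutSize E (fun i => i.1.1) S := by linarith
      exact_mod_cast this
  obtain ⟨e, he⟩ : E.Nonempty := by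
    rw [Finset.nonempty_iff_ne_empty]
    intro hE
    obtain ⟨v⟩ := (inferInstance : Nonempty V)
    have := hG.degree v (Finset.mem_univ v)
    simp [hE, cutSize] at this
  obtain ⟨H, -, hconn, hcost⟩ := exists_twoConnected_subgraph _ Finset.univ E (fun i => i.1.1)
    (fun i => c i.1.1) rfl hG e he
  refine ⟨multiplicity H, ⟨fun S hne hS => ?_, fun e => Nat.cast_nonneg _, fun e =>
    ⟨((H.filter fun i => i.1 = e).card : ℤ), by simp [multiplicity]⟩⟩, ?_⟩
  · rw [sum_cut_multiplicity]
    exact_mod_cast hconn S (Finset.subset_univ S) (Finset.nonempty_iff_ne_empty.2 hne) hS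
  · have h1 : cost c (multiplicity H) = ∑ i ∈ H, c i.1.1 :=
      sum_mul_multiplicity H fun e => c e.1
    have h2 : ∑ i ∈ E, c i.1.1 = 2 * cost c x := by
      rw [← sum_mul_multiplicity E fun e => c e.1, cost, Finset.mul_sum]
      exact Finset.sum_congr rfl fun e _ => by rw [hE]; ring
    -- Nonnegativity lets the deleted edge be counted again, giving `2/3 * 2 = 4/3`.
    have h3 : ∑ i ∈ E.erase e, c i.1.1 ≤ ∑ i ∈ E, c i.1.1 :=
      Finset.sum_le_sum_of_subset_of_nonneg (Finset.erase_subset _ _) fun i _ _ => hc _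
    linarith

theorem finite_tspIP : (tspIP V).Finite := by
  refine (Set.Finite.pi (t := fun _ : Edge V => ({0, 1} : Set ℝ))
    fun _ => Set.toFinite _).subset ?_
  rintro _ ⟨a, T, -, rfl⟩ e -
  unfold incidence
  split_ifs <;> simp

/-- A feasible 2ECM-IP solution that is the unique optimum has positive cost. -/
theorem cost_pos_of_unique_optimal [Nontrivial V] {c : Sym2 V → ℝ} (hc : ∀ e, 0 ≤ c e)
    {t : Edge V → ℝ} (ht : IsOptimalSolution (twoECMIP V) c t)
    (huniq : ∀ x, IsOptimalSolution (twoECMIP V) c x → x = t) : 0 < cost c t := by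
  have hnonneg : 0 ≤ cost c t := Finset.sum_nonneg fun e _ => mul_nonneg (hc _) (ht.1.2.1 e)
  refine hnonneg.lt_of_ne fun h0 => ?_
  -- At cost zero, `2t` would be another optimum; uniqueness forces `t = 0`, which violates a cut
  -- constraint.
  have hcost : cost c (fun e => 2 * t e) = 0 := by
    have : cost c (fun e => 2 * t e) = 2 * cost c t := by
      rw [cost, cost, Finset.mul_sum]
      exact Finset.sum_congr rfl fun e _ => by ring
    rw [this, ← h0, mul_zero]
  have hdouble := huniq (fun e => 2 * t e) ⟨⟨fun S hne hS => ?_, fun e => ?_, fun e => ?_⟩,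
    fun y hy => by rw [hcost, h0]; exact ht.2 y hy⟩
  · have hzero : ∀ e, t e = 0 := fun e => by
      have := congrFun hdouble e
      linarith
    obtain ⟨v, w, hvw⟩ := exists_pair_ne V
    have := ht.1.1 {v} (Finset.singleton_ne_empty v) fun h => hvw.symm <| by
      simpa using h.symm.le (Finset.mem_univ w)
    simp [hzero] at this
    linarith
  · rw [← Finset.mul_sum]
    have := ht.1.1 S hne hS
    linarith
  · have := ht.1.2.1 e
    positivity
  · obtain ⟨k, hk⟩ := ht.1.2.2 e
    exact ⟨2 * k, by simp [hk]⟩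

end Gap

end TourGap

theorem mainTheorem3 {V : Type*} [Fintype V] [DecidableEq V]
    (c : Sym2 V → ℝ) (hc : TourGap.IsMetricCost c)
    {a : V} (T : (⊤ : SimpleGraph V).Walk a a) (hT : T.IsHamiltonianCycle)
    (hTopt : TourGap.IsOptimalSolution (TourGap.twoECMIP V) c (TourGap.incidence T))
    (hTuniq : ∀ x, TourGap.IsOptimalSolution (TourGap.twoECMIP V) c x →
      x = TourGap.incidence T)
    (hhalf : ∃ x, TourGap.IsOptimalSolution (TourGap.twoECMLP V) c x ∧
      TourGap.IsHalfIntegral x) :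
    ∃ optIP optLP : ℝ,
      TourGap.IsOptimalValue (TourGap.tspIP V) c optIP ∧
      TourGap.IsOptimalValue (TourGap.tspLP V) c optLP ∧
      0 < optLP ∧
      optIP / optLP ≤ 4 / 3 := by
  obtain ⟨x, hxopt, hx⟩ := hhalf
  have : Nontrivial V := ⟨a, T.snd, (T.adj_snd hT.isCycle.not_nil).ne⟩
  obtain ⟨y, hy, hyx⟩ := TourGap.exists_twoECMIP_cost_le hc.nonneg hxopt.1 hx
  have hTx := (hTopt.2 y hy).trans hyx
  have hpos := TourGap.cost_pos_of_unique_optimal hc.nonneg hTopt hTuniq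
  have hTmem : TourGap.incidence T ∈ TourGap.tspIP V := ⟨a, T, hT, rfl⟩
  obtain ⟨z, hz, hzmin⟩ := Set.exists_min_image (TourGap.tspIP V) (TourGap.cost c)
    TourGap.finite_tspIP ⟨_, hTmem⟩
  have hxpos : 0 < TourGap.cost c x := by linarith
  refine ⟨TourGap.cost c z, TourGap.cost c x, ⟨⟨z, hz, rfl⟩, ?_⟩, ⟨⟨x, ⟨hxopt.1.1, hxopt.1.2.1,
    fun e => ?_⟩, rfl⟩, ?_⟩, hxpos, ?_⟩
  · rintro _ ⟨w, hw, rfl⟩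
    exact hzmin w hw
  -- Half-integrality supplies the bound `x e ≤ 1` that TSP-LP adds to 2ECM-LP; optimality is then
  -- inherited from the relaxation.
  · rcases hx e with h | h | h <;> rw [h] <;> norm_num
  · rintro _ ⟨w, hw, rfl⟩
    exact hxopt.2 w ⟨hw.1, hw.2.1, fun e => (hw.2.2 e).1⟩
  · rw [div_le_iff₀ hxpos]
    exact (hzmin _ hTmem).trans hTx
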